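/- Let $G$ be a finite complete bipartite multigraph: its vertex set is the disjoint union of two nonempty independent sets $X,Y$, and every $x\in X$ and $y\in Y$ are joined by at least one edge (parallel edges are allowed). Let every edge of $G$ be coloured with colour $1$ or $2$. A walk is \emph{alternating} if any two consecutive edges on it have different colours; for a closed walk, its last and first edge must also have different colours. A trail is a walk that repeats no edge. A 2-edge-coloured graph is \emph{supereulerian} if it contains a spanning closed alternating trail, that is, a closed alternating trail with at least one edge that visits every vertex. An \emph{eulerian factor} of $G$ is a collection of vertex-disjoint induced subgraphs $G_1,\ldots,G_k$ of $G$ that together cover $V(G)$, each of which is supereulerian. $G$ is \emph{colour-connected} if for every two distinct vertices $u,v$ there are two alternating $(u,v)$-paths $P_1,P_2$ whose union (follow $P_1$ from $u$ to $v$ and return along $P_2$) is an alternating closed walk. Then $G$ is supereulerian if and only if $G$ is colour-connected and has an eulerian factor. -/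

import Mathlib

/-! Alternating walks in multigraphs whose edges carry one of two colours.
A multigraph is a Mathlib `Graph α β` (vertex set `V(G)`, edge set `E(G)`, parallel edges allowed);
a 2-edge-colouring is a map `φ : β → Fin 2`, only whose values on `E(G)` matter. -/

open scoped Graph

namespace TwoEdgeColoured

universe u v

/-- Walks in a multigraph `G`, recording the edges that are traversed. -/
inductive Walk {α : Type u} {β : Type v} (G : Graph α β) : α → α → Type (max u v)
  | nil {x : α} (hx : x ∈ V(G)) : Walk G x x
  | cons {x y z : α} (e : β) (h : G.IsLink e x y) (p : Walk G y z) : Walk G x z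

namespace Walk

variable {α : Type u} {β : Type v} {G : Graph α β}

/-- The vertices visited by a walk, in order. -/
def support : {x y : α} → Walk G x y → List α
  | x, _, nil _ => [x]
  | x, _, cons _ _ p => x :: p.support

/-- The edges traversed by a walk, in order. -/
def edges : {x y : α} → Walk G x y → List β
  | _, _, nil _ => []
  | _, _, cons e _ p => e :: p.edges

/-- Concatenation of walks. -/
def append : {x y z : α} → Walk G x y → Walk G y z → Walk G x z
  | _, _, _, nil _, q => q
  | _, _, _, cons e h p, q => cons e h (p.append q)

/-- The walk traversed backwards. -/
def reverse : {x y : α} → Walk G x y → Walk G y x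
  | _, _, nil hx => nil hx
  | _, _, cons e h p => p.reverse.append (cons e h.symm (nil h.left_mem))

/-- A trail repeats no edge. -/
def IsTrail {x y : α} (p : Walk G x y) : Prop := p.edges.Nodup

/-- A path repeats no vertex. -/
def IsPath {x y : α} (p : Walk G x y) : Prop := p.support.Nodup

/-- Consecutive edges of the walk have different colours. -/
def IsAlternating (φ : β → Fin 2) {x y : α} (p : Walk G x y) : Prop :=
  p.edges.IsChain (fun e f => φ e ≠ φ f)

/-- Cyclically consecutive edges of the closed walk have different colours; in particular the
last and the first edge do. -/
def IsClosedAlternating (φ : β → Fin 2) {x : α} (p : Walk G x x) : Prop :=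
  Cycle.Chain (fun e f => φ e ≠ φ f) (p.edges : Cycle β)

end Walk

variable {α : Type u} {β : Type v}

/-- `G` has a spanning closed alternating trail (with at least one edge). -/
def IsSupereulerian (G : Graph α β) (φ : β → Fin 2) : Prop :=
  ∃ (x : α) (T : Walk G x x), T.edges ≠ [] ∧ T.IsTrail ∧ T.IsClosedAlternating φ ∧
    ∀ y ∈ V(G), y ∈ T.support

/-- The vertex set of `G` can be partitioned into finitely many sets, each of which induces a
supereulerian subgraph. -/
def HasEulerianFactor (G : Graph α β) (φ : β → Fin 2) : Prop :=
  ∃ (k : ℕ) (W : Fin k → Set α), Pairwise (fun i j => Disjoint (W i) (W j)) ∧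
    (⋃ i, W i) = V(G) ∧ ∀ i, IsSupereulerian (G.induce (W i)) φ

/-- Any two distinct vertices `x`, `y` are joined by two alternating `(x, y)`-paths whose union
(follow the first one, return along the second one) is an alternating closed walk. -/
def IsColourConnected (G : Graph α β) (φ : β → Fin 2) : Prop :=
  ∀ x ∈ V(G), ∀ y ∈ V(G), x ≠ y → ∃ P Q : Walk G x y,
    P.IsPath ∧ Q.IsPath ∧ P.IsAlternating φ ∧ Q.IsAlternating φ ∧
    (P.append Q.reverse).IsClosedAlternating φ

/-- `G` is a complete bipartite multigraph: `V(G)` is the union of two disjoint nonempty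
independent sets and any two vertices from different sets are joined by at least one edge. -/
def IsCompleteBipartite (G : Graph α β) : Prop :=
  ∃ X Y : Set α, X.Nonempty ∧ Y.Nonempty ∧ Disjoint X Y ∧ X ∪ Y = V(G) ∧
    (∀ a ∈ X, ∀ b ∈ X, ¬ G.Adj a b) ∧ (∀ a ∈ Y, ∀ b ∈ Y, ¬ G.Adj a b) ∧
    ∀ a ∈ X, ∀ b ∈ Y, G.Adj a b

end TwoEdgeColoured

/-!
Let `X` be one side of the bipartition. Orient the edges of colour `0` out of `X` and those of
colour `1` into `X`. The alternating walks are then the directed walks, traversed forwards or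
backwards, so that closed alternating trails become circuits, an eulerian factor becomes a cover of
the vertices by arc-disjoint circuits, and colour-connectedness gives strong connectedness.

Take such a cover with as few circuits as possible. Its members are vertex-disjoint, and the arcs
crossing from one member to another contain no directed cycle, since such a cycle would merge two of
the members. Hence some vertex `x` is the tail of no crossing arc: every neighbour of `x` outside
its member `s` sends an arc to `x`. This property passes from the head `b` to the tail `a` of an arc
of `s`: if instead `a` has an arc to an outside vertex `d`, whose predecessor on its own member is
`c`, then `c` and `b` lie on opposite sides and so are adjacent, hence `c` sends an arc to `b`, and
exchanging `a → b`, `c → d` for `a → d`, `c → b` merges two members. So it holds on all of `s`, and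
an arc leaving `s` would lie on a crossing cycle of length two. By strong connectedness `s` visits
every vertex.
-/

/-- A directed multigraph, in the style of `Graph α β`: `D.IsArc e u v` says that `e` is an arc
from `u` to `v`, and an arc determines its tail and its head. -/
structure Multidigraph (α β : Type*) where
  vertexSet : Set α
  IsArc : β → α → α → Prop
  left_mem_of_isArc : ∀ ⦃e u v⦄, IsArc e u v → u ∈ vertexSet
  right_mem_of_isArc : ∀ ⦃e u v⦄, IsArc e u v → v ∈ vertexSet
  eq_and_eq_of_isArc : ∀ ⦃e u v u' v'⦄, IsArc e u v → IsArc e u' v' → u = u' ∧ v = v'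

namespace Multidigraph

variable {α β : Type*} {D : Multidigraph α β} {u v w a b c d : α} {e f g h : β}
  {l m : List β} {s t z : Multiset β} {L K : Multiset (Multiset β)}

/-- Adjacency in the underlying undirected multigraph. -/
def Adj (D : Multidigraph α β) (u v : α) : Prop := ∃ e, D.IsArc e u v ∨ D.IsArc e v u

/-- `D.IsWalk u l v`: the list `l` of arcs is a directed walk from `u` to `v`. -/
def IsWalk (D : Multidigraph α β) : α → List β → α → Prop
  | u, [], v => u = v
  | u, e :: l, w => ∃ v, D.IsArc e u v ∧ D.IsWalk v l w

theorem isWalk_append :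
    D.IsWalk u (l ++ m) w ↔ ∃ v, D.IsWalk u l v ∧ D.IsWalk v m w := by
  induction l generalizing u with
  | nil => simp [IsWalk]
  | cons e l ih => simp only [List.cons_append, IsWalk, ih]; tauto

theorem IsWalk.append (p : D.IsWalk u l v) (q : D.IsWalk v m w) : D.IsWalk u (l ++ m) w :=
  isWalk_append.2 ⟨v, p, q⟩

theorem IsArc.isWalk (hab : D.IsArc e a b) : D.IsWalk a [e] b := ⟨b, hab, rfl⟩

theorem IsWalk.exists_split_of_mem (p : D.IsWalk u l v) (he : e ∈ l) :
    ∃ l₁ l₂ a b, l = l₁ ++ e :: l₂ ∧ D.IsWalk u l₁ a ∧ D.IsArc e a b ∧ D.IsWalk b l₂ v := by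
  obtain ⟨l₁, l₂, rfl⟩ := List.append_of_mem he
  obtain ⟨a, p₁, b, hab, p₂⟩ := isWalk_append.1 p
  exact ⟨l₁, l₂, a, b, rfl, p₁, hab, p₂⟩

theorem IsWalk.exists_nodup_sublist (p : D.IsWalk u l v) (hl : l ≠ []) :
    ∃ m, m.Sublist l ∧ D.IsWalk u m v ∧ m ≠ [] ∧ m.Nodup := by
  induction l generalizing u with
  | nil => exact absurd rfl hl
  | cons e l ih =>
    obtain ⟨x, hux, p⟩ := p
    rcases eq_or_ne l [] with rfl | hl
    · exact ⟨[e], .refl _, ⟨x, hux, p⟩, by simp, by simp⟩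
    obtain ⟨m, hml, q, -, hm⟩ := ih p hl
    by_cases he : e ∈ m
    · obtain ⟨m₁, m₂, a, b, rfl, -, hab, q₂⟩ := q.exists_split_of_mem he
      obtain ⟨rfl, -⟩ := D.eq_and_eq_of_isArc hux hab
      have hsub : (e :: m₂).Sublist (m₁ ++ e :: m₂) := List.sublist_append_right _ _
      exact ⟨e :: m₂, (hsub.trans hml).cons e, ⟨b, hab, q₂⟩, by simp, hm.sublist hsub⟩
    · exact ⟨e :: m, hml.cons_cons e, ⟨x, hux, q⟩, by simp, List.nodup_cons.2 ⟨he, hm⟩⟩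

theorem IsWalk.backward_induction {S : α → Prop} (p : D.IsWalk u l v)
    (hS : ∀ e ∈ l, ∀ a b, D.IsArc e a b → S b → S a) (hv : S v) : S u := by
  induction l generalizing u with
  | nil => exact (show u = v from p) ▸ hv
  | cons e l ih =>
    obtain ⟨x, hux, p⟩ := p
    exact hS e (by simp) u x hux (ih p fun f hf => hS f (by simp [hf]))

theorem exists_sink_of_acyclic (hfin : D.vertexSet.Finite) (hne : D.vertexSet.Nonempty)
    {P : β → Prop} (hP : ∀ u l, D.IsWalk u l u → (∀ e ∈ l, P e) → l = []) :
    ∃ v ∈ D.vertexSet, ∀ e w, D.IsArc e v w → ¬ P e := by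
  by_contra! hout
  let r : α → α → Prop := fun w v => ∃ l, l ≠ [] ∧ D.IsWalk v l w ∧ ∀ e ∈ l, P e
  have : IsStrictOrder α r :=
    { irrefl := fun u ⟨l, hl, p, hlP⟩ => hl (hP u l p hlP)
      trans := fun _ _ _ ⟨l, hl, p, hlP⟩ ⟨m, _, q, hmP⟩ =>
        ⟨m ++ l, by simp [hl], q.append p, by
          simpa [or_imp, forall_and] using And.intro hmP hlP⟩ }
  obtain ⟨v, hv⟩ := hne
  refine hfin.wellFoundedOn (r := r).induction hv (P := fun _ => False) fun x hx ih => ?_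
  obtain ⟨e, w, hxw, he⟩ := hout x hx
  exact ih w (D.right_mem_of_isArc hxw) ⟨[e], by simp, IsArc.isWalk hxw, by simpa using he⟩

/-- The vertex `v` is the tail of an arc in `s`. When `s` is the set of arcs of a closed walk, these
are all the vertices on that walk. -/
def Visits (D : Multidigraph α β) (s : Multiset β) (v : α) : Prop := ∃ e ∈ s, ∃ w, D.IsArc e v w

@[simp]
theorem not_visits_zero : ¬ D.Visits 0 v := by simp [Visits]

@[simp]
theorem visits_add : D.Visits (s + t) v ↔ D.Visits s v ∨ D.Visits t v := by
  simp only [Visits, Multiset.mem_add, or_and_right, exists_or]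

theorem visits_cons (hab : D.IsArc e a b) : D.Visits (e ::ₘ s) v ↔ v = a ∨ D.Visits s v := by
  have hva : (∃ w, D.IsArc e v w) ↔ v = a :=
    ⟨fun ⟨_, hw⟩ => (D.eq_and_eq_of_isArc hw hab).1, fun hv => ⟨b, hv ▸ hab⟩⟩
  simp only [Visits, Multiset.mem_cons, or_and_right, exists_or, exists_eq_left, hva]

theorem visits_join : D.Visits L.join v ↔ ∃ s ∈ L, D.Visits s v := by
  simp only [Visits, Multiset.mem_join]
  tauto

theorem finite_setOf_visits (D : Multidigraph α β) (s : Multiset β) :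
    {v | D.Visits s v}.Finite := by
  classical
  have htail : ∀ e, {v | ∃ w, D.IsArc e v w}.Subsingleton :=
    fun e _ ⟨_, hv⟩ _ ⟨_, hv'⟩ => (D.eq_and_eq_of_isArc hv hv').1
  refine (s.toFinset.finite_toSet.biUnion fun e _ => (htail e).finite).subset ?_
  rintro v ⟨e, he, w, hvw⟩
  exact Set.mem_biUnion (by simpa using he) ⟨w, hvw⟩

/-- `s` is the multiset of arcs of a closed directed walk with at least one arc. Forgetting the
order of the arcs identifies a closed walk with its rotations. -/
def IsCircuit (D : Multidigraph α β) (s : Multiset β) : Prop :=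
  s ≠ 0 ∧ ∃ u l, D.IsWalk u l u ∧ (l : Multiset β) = s

theorem IsArc.isCircuit_cons (hab : D.IsArc e a b) (p : D.IsWalk b l a) :
    D.IsCircuit (e ::ₘ (l : Multiset β)) :=
  ⟨Multiset.cons_ne_zero, a, e :: l, ⟨b, hab, p⟩, rfl⟩

namespace IsCircuit

theorem exists_isWalk_of_mem (hs : D.IsCircuit s) (he : e ∈ s) (hab : D.IsArc e a b) :
    ∃ l : List β, D.IsWalk b l a ∧ s = e ::ₘ (l : Multiset β) := by
  obtain ⟨-, u, l, p, rfl⟩ := hs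
  obtain ⟨l₁, l₂, a', b', rfl, p₁, hab', p₂⟩ := p.exists_split_of_mem (Multiset.mem_coe.1 he)
  obtain ⟨rfl, rfl⟩ := D.eq_and_eq_of_isArc hab hab'
  exact ⟨l₂ ++ l₁, p₂.append p₁, Multiset.coe_eq_coe.2 List.perm_append_comm⟩

theorem exists_closed_isWalk (hs : D.IsCircuit s) (hv : D.Visits s v) :
    ∃ l : List β, D.IsWalk v l v ∧ (l : Multiset β) = s := by
  obtain ⟨e, he, w, hvw⟩ := hv
  obtain ⟨l, p, rfl⟩ := hs.exists_isWalk_of_mem he hvw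
  exact ⟨e :: l, ⟨w, hvw, p⟩, rfl⟩

theorem visits_right (hs : D.IsCircuit s) (he : e ∈ s) (hab : D.IsArc e a b) :
    D.Visits s b := by
  obtain ⟨l, p, rfl⟩ := hs.exists_isWalk_of_mem he hab
  cases l with
  | nil => exact (show b = a from p) ▸ ⟨e, he, b, hab⟩
  | cons f l =>
    obtain ⟨w, hbw, -⟩ := p
    exact ⟨f, by simp, w, hbw⟩

theorem exists_isArc_right (hs : D.IsCircuit s) (hv : D.Visits s v) :
    ∃ e ∈ s, ∃ u, D.IsArc e u v := by
  obtain ⟨e, he, w, hvw⟩ := hv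
  obtain ⟨l, p, rfl⟩ := hs.exists_isWalk_of_mem he hvw
  rcases l.eq_nil_or_concat with rfl | ⟨l, f, rfl⟩
  · exact ⟨e, he, v, (show w = v from p) ▸ hvw⟩
  · obtain ⟨u, -, v', huv, hv'⟩ := isWalk_append.1 (List.concat_eq_append ▸ p)
    obtain rfl : v' = v := hv'
    exact ⟨f, by simp, u, huv⟩

theorem exists_isWalk (hs : D.IsCircuit s) (hu : D.Visits s u) (hv : D.Visits s v) :
    ∃ l, D.IsWalk u l v ∧ ∀ e ∈ l, e ∈ s := by
  obtain ⟨l, p, rfl⟩ := hs.exists_closed_isWalk hu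
  obtain ⟨e, he, w, hvw⟩ := hv
  obtain ⟨l₁, l₂, a, b, rfl, p₁, hab, -⟩ := p.exists_split_of_mem (Multiset.mem_coe.1 he)
  obtain ⟨rfl, -⟩ := D.eq_and_eq_of_isArc hvw hab
  exact ⟨l₁, p₁, fun f hf => by simp [hf]⟩

theorem add (hs : D.IsCircuit s) (ht : D.IsCircuit t) (hsv : D.Visits s v)
    (htv : D.Visits t v) : D.IsCircuit (s + t) := by
  obtain ⟨l, p, rfl⟩ := hs.exists_closed_isWalk hsv
  obtain ⟨m, q, rfl⟩ := ht.exists_closed_isWalk htv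
  exact ⟨fun h0 => hs.1 (add_eq_zero.1 h0).1, v, l ++ m, p.append q, rfl⟩

end IsCircuit

/-- `L` is a family of arc-disjoint closed trails that together visit every vertex. -/
structure IsCircuitCover (D : Multidigraph α β) (L : Multiset (Multiset β)) : Prop where
  nodup : L.join.Nodup
  isCircuit : ∀ s ∈ L, D.IsCircuit s
  visits : ∀ v ∈ D.vertexSet, D.Visits L.join v

/-- The arc `e` joins two vertices that do not lie on a common member of `L`. -/
def IsCrossing (D : Multidigraph α β) (L : Multiset (Multiset β)) (e : β) : Prop :=
  ∃ u v, D.IsArc e u v ∧ ∀ s ∈ L, ¬ (D.Visits s u ∧ D.Visits s v)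

namespace IsCircuitCover

theorem exists_visits (hL : D.IsCircuitCover L) (hv : v ∈ D.vertexSet) :
    ∃ s ∈ L, D.Visits s v :=
  visits_join.1 (hL.visits v hv)

theorem finite_vertexSet (hL : D.IsCircuitCover L) : D.vertexSet.Finite :=
  (D.finite_setOf_visits L.join).subset hL.visits

theorem nodup_of_mem (hL : D.IsCircuitCover L) (hs : s ∈ L) : s.Nodup := by
  obtain ⟨K, rfl⟩ := Multiset.exists_cons_of_mem hs
  exact (Multiset.nodup_add.1 (Multiset.join_cons s K ▸ hL.nodup)).1

theorem nodup_add_join (hL : D.IsCircuitCover L) (hz : z.Nodup)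
    (hcross : ∀ e ∈ z, D.IsCrossing L e) : (z + L.join).Nodup := by
  refine Multiset.nodup_add.2 ⟨hz, hL.nodup, Multiset.disjoint_left.2 fun {e} he heL => ?_⟩
  obtain ⟨u, v, huv, hcr⟩ := hcross e he
  obtain ⟨s, hs, hes⟩ := Multiset.mem_join.1 heL
  exact hcr s hs ⟨⟨e, hes, v, huv⟩, (hL.isCircuit s hs).visits_right hes huv⟩

end IsCircuitCover

/-- A circuit cover with the least possible number of members. -/
def IsMinimalCircuitCover (D : Multidigraph α β) (L : Multiset (Multiset β)) : Prop :=
  MinimalFor D.IsCircuitCover Multiset.card L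

/-- The vertex `v` receives an arc from each of its neighbours outside `s`. -/
def IsDominatedFromOutside (D : Multidigraph α β) (s : Multiset β) (v : α) : Prop :=
  ∀ w, D.Adj w v → ¬ D.Visits s w → ∃ e, D.IsArc e w v

namespace IsMinimalCircuitCover

/-- Replacing `s` and `t` by `r` would give a smaller cover; the arcs of `z` are used by no member
of `L`. -/
theorem not_exists_merge (hL : D.IsMinimalCircuitCover L) (hs : s ∈ L) (ht : t ∈ L)
    (hst : s ≠ t) (hz : (z + L.join).Nodup) :
    ¬ ∃ r, D.IsCircuit r ∧ r ≤ z + (s + t) ∧ ∀ v, D.Visits (s + t) v → D.Visits r v := by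
  rintro ⟨r, hr, hrle, hrv⟩
  obtain ⟨L', rfl⟩ := Multiset.exists_cons_of_mem hs
  obtain ⟨K, rfl⟩ := Multiset.exists_cons_of_mem ((Multiset.mem_cons.1 ht).resolve_left hst.symm)
  simp only [Multiset.join_cons, ← add_assoc] at hz
  have hcover : D.IsCircuitCover (r ::ₘ K) :=
    { nodup := by
        rw [Multiset.join_cons]
        refine Multiset.nodup_of_le (add_le_add_left ?_ K.join) hz
        rwa [add_assoc]
      isCircuit := (Multiset.forall_mem_cons).2
        ⟨hr, fun k hk => hL.1.isCircuit k (by simp [hk])⟩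
      visits := fun v hv => by
        have := hL.1.visits v hv
        simp only [Multiset.join_cons, ← add_assoc, visits_add (t := K.join)] at this ⊢
        exact this.imp_left (hrv v) }
  have := hL.2 hcover
  simp at this

theorem eq_of_visits (hL : D.IsMinimalCircuitCover L) (hs : s ∈ L) (ht : t ∈ L)
    (hsv : D.Visits s v) (htv : D.Visits t v) : s = t := by
  by_contra hst
  exact hL.not_exists_merge hs ht hst (z := 0) (by simpa using hL.1.nodup)
    ⟨s + t, (hL.1.isCircuit s hs).add (hL.1.isCircuit t ht) hsv htv, by simp, fun _ => id⟩

theorem isCrossing (hL : D.IsMinimalCircuitCover L) (hs : s ∈ L) (huv : D.IsArc e u v)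
    (h : ¬ (D.Visits s u ↔ D.Visits s v)) : D.IsCrossing L e := by
  refine ⟨u, v, huv, fun r hr ⟨hru, hrv⟩ => h ⟨fun hsu => ?_, fun hsv => ?_⟩⟩
  · exact hL.eq_of_visits hr hs hru hsu ▸ hrv
  · exact hL.eq_of_visits hr hs hrv hsv ▸ hru

theorem eq_nil_of_forall_isCrossing (hL : D.IsMinimalCircuitCover L) (p : D.IsWalk u l u)
    (hl : ∀ e ∈ l, D.IsCrossing L e) : l = [] := by
  by_contra hne
  obtain ⟨_ | ⟨e, m⟩, hml, ⟨w, huw, q⟩, hm, hnodup⟩ := p.exists_nodup_sublist hne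
  · exact hm rfl
  have hz : D.IsCircuit ↑(e :: m) := IsArc.isCircuit_cons huw q
  have hzcross : ∀ f ∈ (↑(e :: m) : Multiset β), D.IsCrossing L f :=
    fun f hf => hl f (hml.subset hf)
  obtain ⟨s, hs, hsu⟩ := hL.1.exists_visits (D.left_mem_of_isArc huw)
  obtain ⟨t, ht, htw⟩ := hL.1.exists_visits (D.right_mem_of_isArc huw)
  have hst : s ≠ t := by
    rintro rfl
    obtain ⟨u', w', huw', hcr⟩ := hzcross e (by simp)
    obtain ⟨rfl, rfl⟩ := D.eq_and_eq_of_isArc huw huw'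
    exact hcr s hs ⟨hsu, htw⟩
  have hzs := hz.add (hL.1.isCircuit s hs) ⟨e, by simp, w, huw⟩ hsu
  have hzst := hzs.add (hL.1.isCircuit t ht)
    (visits_add.2 (.inl (hz.visits_right (by simp) huw))) htw
  refine hL.not_exists_merge hs ht hst (hL.1.nodup_add_join (Multiset.coe_nodup.2 hnodup) hzcross)
    ⟨_, hzst, (add_assoc _ _ _).le, fun v hv => ?_⟩
  rw [add_assoc]
  exact visits_add.2 (.inr hv)

/-- Otherwise `a → d ⇝ c → b ⇝ a` would merge the two members: it follows `t` from `d` to `c`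
and `s` from `b` to `a`. -/
theorem not_exists_exchange (hL : D.IsMinimalCircuitCover L) (hs : s ∈ L) (ht : t ∈ L)
    (hst : s ≠ t) (he : e ∈ s) (hab : D.IsArc e a b) (hf : f ∈ t) (hcd : D.IsArc f c d) :
    ¬ ((∃ g, D.IsArc g a d) ∧ ∃ h, D.IsArc h c b) := by
  rintro ⟨⟨g, had⟩, h, hcb⟩
  have hsa : D.Visits s a := ⟨e, he, b, hab⟩
  have htc : D.Visits t c := ⟨f, hf, d, hcd⟩
  have hsb := (hL.1.isCircuit s hs).visits_right he hab
  have htd := (hL.1.isCircuit t ht).visits_right hf hcd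
  have hsd : ¬ D.Visits s d := fun h => hst (hL.eq_of_visits hs ht h htd)
  have hsc : ¬ D.Visits s c := fun h => hst (hL.eq_of_visits hs ht h htc)
  have hgh : g ≠ h := by
    rintro rfl
    exact hsc ((D.eq_and_eq_of_isArc had hcb).1 ▸ hsa)
  have hcross : ∀ k ∈ ({g, h} : Multiset β), D.IsCrossing L k := by
    simp only [Multiset.insert_eq_cons, Multiset.mem_cons, Multiset.mem_singleton, forall_eq_or_imp,
      forall_eq]
    exact ⟨hL.isCrossing hs had (by tauto), hL.isCrossing hs hcb (by tauto)⟩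
  obtain ⟨l, p, hl⟩ := (hL.1.isCircuit s hs).exists_isWalk_of_mem he hab
  obtain ⟨m, q, hm⟩ := (hL.1.isCircuit t ht).exists_isWalk_of_mem hf hcd
  have hr : D.IsCircuit (g ::ₘ ↑(m ++ h :: l)) :=
    IsArc.isCircuit_cons had (q.append ⟨b, hcb, p⟩)
  have hr_eq : g ::ₘ (↑(m ++ h :: l) : Multiset β) = g ::ₘ h ::ₘ (l + m : Multiset β) := by
    rw [← Multiset.coe_add, ← Multiset.cons_coe, Multiset.add_cons, add_comm]
  rw [hr_eq] at hr
  refine hL.not_exists_merge hs ht hst (hL.1.nodup_add_join (by simpa using hgh) hcross)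
    ⟨_, hr, ?_, fun v hv => ?_⟩
  · have hls : (l : Multiset β) ≤ s := hl ▸ Multiset.le_cons_self _ _
    have hmt : (m : Multiset β) ≤ t := hm ▸ Multiset.le_cons_self _ _
    simpa only [Multiset.insert_eq_cons, Multiset.cons_add, Multiset.singleton_add,
      Multiset.cons_le_cons_iff] using add_le_add hls hmt
  · rw [hl, hm, visits_add, visits_cons hab, visits_cons hcd] at hv
    rw [visits_cons had, visits_cons hcb, visits_add]
    tauto

theorem isDominatedFromOutside_left (hL : D.IsMinimalCircuitCover L)
    (hadj : ∀ ⦃a b c d⦄, D.Adj a b → D.Adj b c → D.Adj c d → a ≠ d → D.Adj a d)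
    (hs : s ∈ L) (he : e ∈ s) (hab : D.IsArc e a b) (hb : D.IsDominatedFromOutside s b) :
    D.IsDominatedFromOutside s a := by
  intro d hda hsd
  obtain ⟨t, ht, htd⟩ : ∃ t ∈ L, D.Visits t d := hL.1.exists_visits <| by
    obtain ⟨g, hg | hg⟩ := hda
    exacts [D.left_mem_of_isArc hg, D.right_mem_of_isArc hg]
  obtain ⟨f, hf, c, hcd⟩ := (hL.1.isCircuit t ht).exists_isArc_right htd
  have hst : s ≠ t := fun h => hsd (h ▸ htd)
  have hsc : ¬ D.Visits s c := fun h => hst (hL.eq_of_visits hs ht h ⟨f, hf, d, hcd⟩)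
  have hcb : c ≠ b := fun h => hsc (h ▸ (hL.1.isCircuit s hs).visits_right he hab)
  have hcb_arc := hb c (hadj ⟨f, .inl hcd⟩ hda ⟨e, .inl hab⟩ hcb) hsc
  obtain ⟨g, hda | had⟩ := hda
  · exact ⟨g, hda⟩
  · exact (hL.not_exists_exchange hs ht hst he hab hf hcd ⟨⟨g, had⟩, hcb_arc⟩).elim

end IsMinimalCircuitCover

/-- The hypothesis `hadj` holds when the underlying graph is complete bipartite or complete. -/
theorem exists_spanning_circuit (hne : D.vertexSet.Nonempty)
    (hadj : ∀ ⦃a b c d⦄, D.Adj a b → D.Adj b c → D.Adj c d → a ≠ d → D.Adj a d)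
    (hstrong : ∀ u ∈ D.vertexSet, ∀ v ∈ D.vertexSet, ∃ l, D.IsWalk u l v)
    (hcover : ∃ L, D.IsCircuitCover L) :
    ∃ s, D.IsCircuit s ∧ s.Nodup ∧ ∀ v ∈ D.vertexSet, D.Visits s v := by
  obtain ⟨L, hL⟩ : ∃ L, D.IsMinimalCircuitCover L :=
    exists_minimalFor_of_wellFoundedLT _ _ hcover
  obtain ⟨x, hx, hsink⟩ := exists_sink_of_acyclic hL.1.finite_vertexSet hne
    fun _ _ => hL.eq_nil_of_forall_isCrossing
  obtain ⟨s, hs, hsx⟩ := hL.1.exists_visits hx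
  have hdom_sink : D.IsDominatedFromOutside s x := by
    rintro w ⟨e, hwx | hxw⟩ hsw
    · exact ⟨e, hwx⟩
    · exact (hsink e w hxw (hL.isCrossing hs hxw (by tauto))).elim
  have hdom : ∀ v, D.Visits s v → D.IsDominatedFromOutside s v := fun v hsv => by
    obtain ⟨l, p, hls⟩ := (hL.1.isCircuit s hs).exists_isWalk hsv hsx
    exact p.backward_induction (fun e he _ _ hab =>
      hL.isDominatedFromOutside_left hadj hs (hls e he) hab) hdom_sink
  have hclosed : ∀ e a b, D.IsArc e a b → ¬ D.Visits s b → ¬ D.Visits s a := by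
    intro e a b hab hsb hsa
    obtain ⟨f, hba⟩ := hdom a hsa b ⟨e, .inr hab⟩ hsb
    have h2cycle := hL.eq_nil_of_forall_isCrossing (l := [e, f]) ⟨b, hab, a, hba, rfl⟩ <| by
      simpa using ⟨hL.isCrossing hs hab (by tauto), hL.isCrossing hs hba (by tauto)⟩
    simp at h2cycle
  refine ⟨s, hL.1.isCircuit s hs, hL.1.nodup_of_mem hs, fun w hw => ?_⟩
  by_contra hsw
  obtain ⟨l, p⟩ := hstrong x hx w hw
  exact p.backward_induction (fun e _ => hclosed e) hsw hsx

end Multidigraph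

namespace TwoEdgeColoured

variable {α β : Type*} {G H : Graph α β} {D : Multidigraph α β} {φ : β → Fin 2} {X W : Set α}
  {x y z u v w : α} {e f : β} {l : List β}

namespace Walk

@[simp]
theorem edges_append (p : Walk G x y) (q : Walk G y z) :
    (p.append q).edges = p.edges ++ q.edges := by
  induction p with
  | nil => rfl
  | cons e h p ih => simp [append, edges, ih]

@[simp]
theorem edges_reverse (p : Walk G x y) : p.reverse.edges = p.edges.reverse := by
  induction p with
  | nil => rfl
  | cons e h p ih => simp [reverse, edges, ih]

theorem mem_edgeSet_of_mem_edges (p : Walk G x y) (he : e ∈ p.edges) : e ∈ E(G) := by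
  induction p with
  | nil => cases he
  | cons f h p ih =>
    rcases List.mem_cons.1 he with rfl | he
    exacts [h.edge_mem, ih he]

theorem edges_ne_nil_of_ne (p : Walk G x y) (hxy : x ≠ y) : p.edges ≠ [] := by
  cases p with
  | nil => exact absurd rfl hxy
  | cons => exact List.cons_ne_nil _ _

theorem support_append (p : Walk G x y) (q : Walk G y z) :
    (p.append q).support = p.support ++ q.support.tail := by
  induction p with
  | nil => cases q <;> rfl
  | cons e h p ih => simp [append, support, ih]

@[simp]
theorem support_reverse (p : Walk G x y) : p.reverse.support = p.support.reverse := by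
  induction p with
  | nil => rfl
  | cons e h p ih => simp [reverse, support, support_append, ih]

theorem start_mem_support (p : Walk G x y) : x ∈ p.support := by
  cases p <;> exact List.mem_cons_self

theorem end_mem_support (p : Walk G x y) : y ∈ p.support := by
  simpa using p.reverse.start_mem_support

theorem IsPath.reverse {p : Walk G x y} (hp : p.IsPath) : p.reverse.IsPath := by
  simpa [IsPath] using hp

theorem IsAlternating.reverse {p : Walk G x y} (hp : p.IsAlternating φ) :
    p.reverse.IsAlternating φ := by
  simpa [IsAlternating, List.isChain_reverse, ne_comm] using hp

theorem IsClosedAlternating.isAlternating {p : Walk G x x} (hp : p.IsClosedAlternating φ) :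
    p.IsAlternating φ := by
  unfold IsClosedAlternating at hp
  unfold IsAlternating
  cases h : p.edges with
  | nil => exact .nil
  | cons e l =>
    rw [h, Cycle.chain_coe_cons] at hp
    exact List.IsChain.left_of_append (l₂ := [e]) hp

theorem IsClosedAlternating.colour_getLast?_ne_colour_head? {p : Walk G x x}
    (hp : p.IsClosedAlternating φ) (he : e ∈ p.edges.head?) (hf : f ∈ p.edges.getLast?) :
    φ f ≠ φ e := by
  obtain ⟨l, hl⟩ := List.head?_eq_some_iff.1 he
  rw [IsClosedAlternating, hl, Cycle.chain_coe_cons, ← List.cons_append,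
    List.isChain_append] at hp
  exact hp.2.2 f (hl ▸ hf) e rfl

/-- Every edge of the walk is an arc of `D` and is traversed from its tail to its head. -/
def IsDirected (D : Multidigraph α β) : {x y : α} → Walk G x y → Prop
  | _, _, nil _ => True
  | x, _, cons (y := y) e _ p => D.IsArc e x y ∧ p.IsDirected D

namespace IsDirected

theorem isWalk {p : Walk G x y} (hp : p.IsDirected D) : D.IsWalk x p.edges y := by
  induction p with
  | nil => rfl
  | cons e h p ih => exact ⟨_, hp.1, ih hp.2⟩

theorem mem_support_iff {p : Walk G x y} (hp : p.IsDirected D) :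
    v ∈ p.support ↔ D.Visits p.edges v ∨ v = y := by
  induction p with
  | nil => simp [support, edges]
  | cons e h p ih =>
    simp only [support, edges, List.mem_cons, ← Multiset.cons_coe, Multidigraph.visits_cons hp.1,
      ih hp.2, or_assoc]

theorem isCircuit {p : Walk G x x} (hp : p.IsDirected D) (hne : p.edges ≠ []) :
    D.IsCircuit p.edges :=
  ⟨by simpa using hne, x, p.edges, hp.isWalk, rfl⟩

theorem visits_of_mem_support {p : Walk G x x} (hp : p.IsDirected D) (hne : p.edges ≠ [])
    (hv : v ∈ p.support) : D.Visits p.edges v := by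
  rcases hp.mem_support_iff.1 hv with hv | rfl
  · exact hv
  · cases p with
    | nil => exact absurd rfl hne
    | cons e h p => exact ⟨e, by simp [edges], _, hp.1⟩

theorem exists_isSuffix {p : Walk G x y} (hp : p.IsDirected D) (hv : v ∈ p.support) :
    ∃ q : Walk G v y, q.support <:+ p.support ∧ q.IsDirected D := by
  induction p with
  | nil hx =>
    obtain rfl := List.mem_singleton.1 hv
    exact ⟨.nil hx, List.suffix_rfl, hp⟩
  | cons e h p ih =>
    rcases List.mem_cons.1 hv with rfl | hv
    · exact ⟨.cons e h p, List.suffix_rfl, hp⟩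
    · obtain ⟨q, hqp, hq⟩ := ih hp.2 hv
      exact ⟨q, hqp.trans (List.suffix_cons _ _), hq⟩

end IsDirected

theorem exists_isDirected_edges_eq (hD : ∀ e u v, D.IsArc e u v → G.IsLink e u v)
    (p : D.IsWalk x l y) (hy : y ∈ V(G)) : ∃ q : Walk G x y, q.IsDirected D ∧ q.edges = l := by
  induction l generalizing x with
  | nil =>
    obtain rfl : x = y := p
    exact ⟨.nil hy, trivial, rfl⟩
  | cons e l ih =>
    obtain ⟨z, hxz, p⟩ := p
    obtain ⟨q, hq, rfl⟩ := ih p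
    exact ⟨.cons e (hD e x z hxz) q, ⟨hxz, hq⟩, rfl⟩

theorem IsDirected.exists_isPath {p : Walk G x y} (hp : p.IsDirected D) :
    ∃ q : Walk G x y, q.IsPath ∧ q.IsDirected D := by
  induction p with
  | nil hx => exact ⟨.nil hx, List.nodup_singleton _, trivial⟩
  | @cons x _ _ e h p ih =>
    obtain ⟨q, hq, hqD⟩ := ih hp.2
    by_cases hx : x ∈ q.support
    · obtain ⟨r, hrq, hr⟩ := hqD.exists_isSuffix hx
      exact ⟨r, hrq.sublist.nodup hq, hr⟩
    · exact ⟨.cons e h q, List.nodup_cons.2 ⟨hx, hq⟩, hp.1, hqD⟩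

end Walk

/-- Every edge of `G` has exactly one end in `X`. -/
def IsBipartiteSide (G : Graph α β) (X : Set α) : Prop :=
  ∀ ⦃e u v⦄, G.IsLink e u v → (u ∈ X ↔ v ∉ X)

/-- The orientation of `G` in which the edges of colour `0` leave `X` and those of colour `1`
enter `X`. Its directed walks are alternating. -/
def orientation (φ : β → Fin 2) (hX : IsBipartiteSide G X) : Multidigraph α β where
  vertexSet := V(G)
  IsArc e u v := G.IsLink e u v ∧ (u ∈ X ↔ φ e = 0)
  left_mem_of_isArc _ _ _ h := h.1.left_mem
  right_mem_of_isArc _ _ _ h := h.1.right_mem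
  eq_and_eq_of_isArc e u v u' v' h h' := by
    rcases h.1.eq_and_eq_or_eq_and_eq h'.1 with heq | ⟨rfl, rfl⟩
    · exact heq
    · have := hX h.1
      have := h.2
      have := h'.2
      tauto

variable {hX : IsBipartiteSide G X}

theorem isLink_of_isArc (h : (orientation φ hX).IsArc e u v) : G.IsLink e u v := h.1

theorem orientation_adj : (orientation φ hX).Adj u v ↔ G.Adj u v := by
  refine ⟨fun ⟨e, h⟩ => ⟨e, h.elim (·.1) (·.1.symm)⟩, fun ⟨e, h⟩ => ⟨e, ?_⟩⟩
  by_cases hu : u ∈ X ↔ φ e = 0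
  · exact .inl ⟨h, hu⟩
  · exact .inr ⟨h.symm, by have := hX h; tauto⟩

theorem colour_ne_of_isArc (he : (orientation φ hX).IsArc e u v)
    (hf : (orientation φ hX).IsArc f v w) : φ e ≠ φ f := by
  intro hef
  have := he.2.symm.trans (hX he.1)
  rw [hef, hf.2] at this
  tauto

theorem isChain_colour_of_isWalk (p : (orientation φ hX).IsWalk x l y) :
    l.IsChain (fun e f => φ e ≠ φ f) := by
  induction l generalizing x with
  | nil => exact .nil
  | cons e l ih =>
    obtain ⟨z, hxz, p⟩ := p
    cases l with
    | nil => exact .singleton e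
    | cons f l =>
      obtain ⟨w, hzw, -⟩ := id p
      exact .cons_cons (colour_ne_of_isArc hxz hzw) (ih p)

theorem chain_colour_of_isWalk (p : (orientation φ hX).IsWalk x l x) :
    Cycle.Chain (fun e f => φ e ≠ φ f) (l : Cycle β) := by
  cases l with
  | nil => exact Cycle.Chain.nil _
  | cons e l =>
    rw [Cycle.chain_coe_cons]
    obtain ⟨y, hxy, -⟩ := id p
    exact isChain_colour_of_isWalk (p.append hxy.isWalk)

theorem Walk.IsAlternating.isDirected {p : Walk H x y} (hp : p.IsAlternating φ) (hH : H ≤ G)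
    (hhead : ∀ e ∈ p.edges.head?, (x ∈ X ↔ φ e = 0)) : p.IsDirected (orientation φ hX) := by
  induction p with
  | nil => trivial
  | cons e h p ih =>
    obtain ⟨hef, hp⟩ := List.isChain_cons.1 hp
    have hx := hhead e rfl
    refine ⟨⟨h.mono hH, hx⟩, ih hp fun f hf => ?_⟩
    have hcolours : φ e = 0 ↔ φ f ≠ 0 := by have := hef f hf; omega
    have hsides := hX (h.mono hH)
    tauto

namespace Walk.IsClosedAlternating

variable {p : Walk H x x}

theorem isDirected_or_isDirected_reverse (hp : p.IsClosedAlternating φ) (hH : H ≤ G) :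
    p.IsDirected (orientation φ hX) ∨ p.reverse.IsDirected (orientation φ hX) := by
  by_cases hhead : ∀ e ∈ p.edges.head?, (x ∈ X ↔ φ e = 0)
  · exact .inl (hp.isAlternating.isDirected hH hhead)
  · refine .inr (hp.isAlternating.reverse.isDirected hH fun f hf => ?_)
    rw [edges_reverse, List.head?_reverse] at hf
    push Not at hhead
    obtain ⟨e, he, hxe⟩ := hhead
    have := hp.colour_getLast?_ne_colour_head? he hf
    have hcolours : φ e = 0 ↔ φ f ≠ 0 := by omega
    tauto

theorem isCircuit (hp : p.IsClosedAlternating φ) (hH : H ≤ G) (hne : p.edges ≠ []) :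
    (orientation φ hX).IsCircuit p.edges := by
  rcases hp.isDirected_or_isDirected_reverse hH with h | h
  · exact h.isCircuit hne
  · simpa using h.isCircuit (by simpa using hne)

theorem visits_of_mem_support (hp : p.IsClosedAlternating φ) (hH : H ≤ G) (hne : p.edges ≠ [])
    (hv : v ∈ p.support) : (orientation φ hX).Visits p.edges v := by
  rcases hp.isDirected_or_isDirected_reverse hH with h | h
  · exact h.visits_of_mem_support hne hv
  · simpa using h.visits_of_mem_support (by simpa using hne) (by simpa using hv)

end Walk.IsClosedAlternating

theorem isSupereulerian_of_isCircuit {s : Multiset β} (hs : (orientation φ hX).IsCircuit s)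
    (hnodup : s.Nodup) (hV : ∀ v ∈ V(G), (orientation φ hX).Visits s v) :
    IsSupereulerian G φ := by
  obtain ⟨hne, x, _ | ⟨e, l⟩, p, rfl⟩ := hs
  · exact absurd rfl hne
  obtain ⟨y, hxy, -⟩ := id p
  obtain ⟨T, hT, hTl⟩ :=
    Walk.exists_isDirected_edges_eq (fun _ _ _ => isLink_of_isArc) p hxy.1.left_mem
  refine ⟨x, T, by simp [hTl], ?_, ?_, fun v hv => ?_⟩
  · simpa [Walk.IsTrail, hTl] using hnodup
  · simpa [Walk.IsClosedAlternating, hTl] using chain_colour_of_isWalk p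
  · exact hT.mem_support_iff.2 (.inl (hTl ▸ hV v hv))

theorem IsSupereulerian.isColourConnected (h : IsSupereulerian G φ) (hX : IsBipartiteSide G X) :
    IsColourConnected G φ := by
  obtain ⟨z, T, hne, -, hT, hV⟩ := h
  have hcircuit := hT.isCircuit (hX := hX) le_rfl hne
  have hpath : ∀ u ∈ V(G), ∀ v ∈ V(G), ∃ P : Walk G u v,
      P.IsPath ∧ P.IsDirected (orientation φ hX) := fun u hu v hv => by
    obtain ⟨l, p, -⟩ := hcircuit.exists_isWalk (hT.visits_of_mem_support le_rfl hne (hV u hu))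
      (hT.visits_of_mem_support le_rfl hne (hV v hv))
    obtain ⟨q, hq, -⟩ := Walk.exists_isDirected_edges_eq (fun _ _ _ => isLink_of_isArc) p hv
    exact hq.exists_isPath
  intro x hx y hy _
  obtain ⟨P, hP, hPD⟩ := hpath x hx y hy
  obtain ⟨Q, hQ, hQD⟩ := hpath y hy x hx
  have hQalt : Q.IsAlternating φ := isChain_colour_of_isWalk hQD.isWalk
  refine ⟨P, Q.reverse, hP, hQ.reverse, isChain_colour_of_isWalk hPD.isWalk, hQalt.reverse, ?_⟩
  simpa [Walk.IsClosedAlternating] using chain_colour_of_isWalk (hPD.isWalk.append hQD.isWalk)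

theorem IsColourConnected.exists_isWalk (h : IsColourConnected G φ) (hX : IsBipartiteSide G X)
    (hx : x ∈ V(G)) (hy : y ∈ V(G)) : ∃ l, (orientation φ hX).IsWalk x l y := by
  rcases eq_or_ne x y with rfl | hxy
  · exact ⟨[], rfl⟩
  obtain ⟨P, Q, -, -, -, -, hPQ⟩ := h x hx y hy hxy
  have hne : (P.append Q.reverse).edges ≠ [] := by simp [P.edges_ne_nil_of_ne hxy]
  have hy_mem : y ∈ (P.append Q.reverse).support := by
    rw [Walk.support_append]
    exact List.mem_append_left _ P.end_mem_support
  obtain ⟨l, p, -⟩ := (hPQ.isCircuit (hX := hX) le_rfl hne).exists_isWalk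
    (hPQ.visits_of_mem_support le_rfl hne (Walk.start_mem_support _))
    (hPQ.visits_of_mem_support le_rfl hne hy_mem)
  exact ⟨l, p⟩

theorem IsSupereulerian.hasEulerianFactor (h : IsSupereulerian G φ) : HasEulerianFactor G φ :=
  ⟨1, fun _ => V(G), Subsingleton.pairwise, Set.iUnion_const _,
    fun _ => by rwa [Graph.induce_vertexSet]⟩

theorem disjoint_edgeSet_induce {W' : Set α} (h : Disjoint W W') :
    Disjoint E(G.induce W) E(G.induce W') := by
  refine Set.disjoint_left.2 fun e he he' => ?_
  obtain ⟨u, v, huv, hu, -⟩ := Graph.exists_isLink_of_mem_edgeSet he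
  obtain ⟨u', v', huv', hu', hv'⟩ := Graph.exists_isLink_of_mem_edgeSet he'
  rcases huv.eq_and_eq_or_eq_and_eq huv' with ⟨rfl, rfl⟩ | ⟨rfl, rfl⟩
  exacts [Set.disjoint_left.1 h hu hu', Set.disjoint_left.1 h hu hv']

theorem HasEulerianFactor.exists_isCircuitCover (h : HasEulerianFactor G φ)
    (hX : IsBipartiteSide G X) : ∃ L, (orientation φ hX).IsCircuitCover L := by
  obtain ⟨k, W, hW, hWV, hWs⟩ := h
  choose x T hne hTtrail hT hTW using hWs
  have hle : ∀ i, G.induce (W i) ≤ G := fun i => Graph.induce_le (hWV ▸ Set.subset_iUnion W i)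
  refine ⟨Finset.univ.val.map fun i => (T i).edges, ?_, ?_, fun v hv => ?_⟩
  · refine Multiset.nodup_bind.2 ⟨fun i _ => hTtrail i, Finset.univ.nodup.pairwise ?_⟩
    intro i _ j _ hij
    exact Multiset.disjoint_left.2 fun he he' => Set.disjoint_left.1
      (disjoint_edgeSet_induce (hW hij)) ((T i).mem_edgeSet_of_mem_edges he)
      ((T j).mem_edgeSet_of_mem_edges he')
  · simpa using fun i => (hT i).isCircuit (hX := hX) (hle i) (hne i)
  · obtain ⟨i, hi⟩ := Set.mem_iUnion.1 (hWV ▸ hv : v ∈ ⋃ i, W i)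
    exact Multidigraph.visits_join.2 ⟨_, Multiset.mem_map_of_mem _ (Finset.mem_univ i),
      (hT i).visits_of_mem_support (hle i) (hne i) (hTW i v hi)⟩

namespace IsCompleteBipartite

theorem vertexSet_nonempty (h : IsCompleteBipartite G) : V(G).Nonempty := by
  obtain ⟨X, Y, hX, -, -, hV, -⟩ := h
  exact hV ▸ hX.inl

theorem exists_isBipartiteSide_adj (h : IsCompleteBipartite G) : ∃ X, IsBipartiteSide G X ∧
    ∀ u ∈ V(G), ∀ v ∈ V(G), (u ∈ X ↔ v ∉ X) → G.Adj u v := by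
  obtain ⟨X, Y, -, -, -, hV, hXX, hYY, hadj⟩ := h
  have hY : ∀ v ∈ V(G), v ∉ X → v ∈ Y := fun v hv => (hV ▸ hv : v ∈ X ∪ Y).resolve_left
  refine ⟨X, fun e u v huv => ⟨fun hu hv => hXX u hu v hv ⟨e, huv⟩, fun hv => ?_⟩, ?_⟩
  · by_contra hu
    exact hYY u (hY u huv.left_mem hu) v (hY v huv.right_mem hv) ⟨e, huv⟩
  · intro u hu v hv huv
    by_cases huX : u ∈ X
    · exact hadj u huX v (hY v hv (huv.1 huX))
    · exact (hadj v (by tauto) u (hY u hu huX)).symm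

end IsCompleteBipartite

end TwoEdgeColoured

theorem mainTheorem9_general {α β : Type*} (G : Graph α β) (φ : β → Fin 2)
    (hG : TwoEdgeColoured.IsCompleteBipartite G) :
    TwoEdgeColoured.IsSupereulerian G φ ↔
      TwoEdgeColoured.IsColourConnected G φ ∧ TwoEdgeColoured.HasEulerianFactor G φ := by
  obtain ⟨X, hX, hcomplete⟩ := hG.exists_isBipartiteSide_adj
  refine ⟨fun h => ⟨h.isColourConnected hX, h.hasEulerianFactor⟩, fun ⟨hconn, hfactor⟩ => ?_⟩
  have hadj : ∀ ⦃a b c d⦄, G.Adj a b → G.Adj b c → G.Adj c d → G.Adj a d := by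
    rintro a b c d ⟨e, hab⟩ ⟨f, hbc⟩ ⟨g, hcd⟩
    refine hcomplete a hab.left_mem d hcd.right_mem ?_
    rw [hX hab, hX hbc, hX hcd, not_not]
  obtain ⟨s, hs, hnodup, hspan⟩ := (TwoEdgeColoured.orientation φ hX).exists_spanning_circuit
    hG.vertexSet_nonempty
    (fun a b c d hab hbc hcd _ => by
      simp only [TwoEdgeColoured.orientation_adj] at hab hbc hcd ⊢
      exact hadj hab hbc hcd)
    (fun u hu v hv => hconn.exists_isWalk hX hu hv) (hfactor.exists_isCircuitCover hX)
  exact TwoEdgeColoured.isSupereulerian_of_isCircuit hs hnodup hspan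

theorem mainTheorem9 {α β : Type*} (G : Graph α β) (hV : V(G).Finite) (hE : E(G).Finite)
    (φ : β → Fin 2) (hG : TwoEdgeColoured.IsCompleteBipartite G) :
    TwoEdgeColoured.IsSupereulerian G φ ↔
      TwoEdgeColoured.IsColourConnected G φ ∧ TwoEdgeColoured.HasEulerianFactor G φ :=
  mainTheorem9_general G φ hG
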